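/- Let $Z$ be a random variable with values in $\{0,1,2,\dots\}$ and $\mathbf{E}Z=1$, in the domain of attraction of a stable law with index $\alpha\in(1,2]$; that is, there is a sequence $a_n\uparrow\infty$ such that \[\frac{Z[n]-n}{a_n}\xrightarrow{d}X,\] where $Z[n]$ is the sum of $n$ independent copies of $Z$ and $X$ is a real random variable with $\mathbf{E}(e^{-rX})=e^{r^{\alpha}}$ for all $r>0$. Let $T$ be the Galton–Watson tree (a rooted ordered tree started from one individual) with offspring distribution $Z$, let $Z_n$ be the number of individuals in its $n$th generation, and put $p_n:=\mathbf{P}(Z_n>0)$. Let $T^*$ be $T$ conditioned to survive, i.e. the random rooted, locally finite ordered tree whose law is determined by \[\mathbf{E}\left(\phi(T^*|_n)\right)=\lim_{m\to\infty}\mathbf{E}\left(\phi(T|_n)\,\middle|\,Z_{m+n}>0\right)\] for all $n\ge 0$ and all bounded functions $\phi$ of trees of $n$ generations, where $T|_n$ and $T^*|_n$ are the first $n$ generations of $T$ and $T^*$. Let $Z^*_n$ be the number of individuals in the $n$th generation of $T^*$. Then for every $\beta\in(0,\alpha-1)$ there exists a finite constant $c$ such that \[\mathbf{P}\left(Z_n^*\leq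 \lambda p_n^{-1}\right)\leq c\,\lambda^{\beta}\qquad\text{for all integers } n\ge 0 \text{ and all } \lambda>0.\] -/

import Mathlib

open MeasureTheory ProbabilityTheory Filter Topology
open scoped ENNReal

/-- Rooted, locally finite, ordered (Ulam-Harris) trees. A vertex is a finite word of natural
numbers; the root is the empty word, the children of `u` are the words `u ++ [i]`, and the children
present in the tree are the ones with `i < k` for some finite number `k`. -/
@[ext]
structure PlaneTree where
  verts : Set (List ℕ)
  nil_mem : [] ∈ verts
  parent_mem : ∀ (u : List ℕ) (i : ℕ), u ++ [i] ∈ verts → u ∈ verts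
  children : ∀ u ∈ verts, ∃ k : ℕ, ∀ i : ℕ, u ++ [i] ∈ verts ↔ i < k

namespace PlaneTree

/-- The `n`-th generation of the tree. -/
def gen (t : PlaneTree) (n : ℕ) : Set (List ℕ) := {u | u ∈ t.verts ∧ u.length = n}

theorem gen_finite (t : PlaneTree) (n : ℕ) : (t.gen n).Finite := by
  induction n with
  | zero =>
    refine (Set.finite_singleton ([] : List ℕ)).subset ?_
    rintro u ⟨-, hu⟩
    exact List.length_eq_zero_iff.mp hu
  | succ n ih =>
    have hfin : ∀ u ∈ t.gen n, {w | ∃ i : ℕ, w = u ++ [i] ∧ w ∈ t.verts}.Finite := by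
      intro u hu
      obtain ⟨k, hk⟩ := t.children u hu.1
      refine ((Set.finite_Iio k).image (fun i => u ++ [i])).subset ?_
      rintro w ⟨i, rfl, hw⟩
      exact ⟨i, (hk i).mp hw, rfl⟩
    refine (ih.biUnion hfin).subset ?_
    rintro w ⟨hw, hl⟩
    rcases List.eq_nil_or_concat w with rfl | ⟨u, i, rfl⟩
    · simp at hl
    · rw [List.concat_eq_append] at hw hl ⊢
      refine Set.mem_biUnion (x := u) ⟨t.parent_mem u i hw, ?_⟩ ⟨i, rfl, hw⟩
      simpa using hl

/-- The size of the `n`-th generation; generations are finite by `gen_finite`. -/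
noncomputable def genSize (n : ℕ) (t : PlaneTree) : ℕ := (t.gen n).ncard

/-- The first `n` generations `t|ₙ` of the tree. -/
def trunc (n : ℕ) (t : PlaneTree) : PlaneTree where
  verts := {u | u ∈ t.verts ∧ u.length ≤ n}
  nil_mem := ⟨t.nil_mem, by simp⟩
  parent_mem := fun u i h => ⟨t.parent_mem u i h.1, by
    have := h.2
    simp only [List.length_append, List.length_singleton] at this
    omega⟩
  children := by
    rintro u ⟨hu, hl⟩
    obtain ⟨k, hk⟩ := t.children u hu
    rcases hl.lt_or_eq with h | h
    · refine ⟨k, fun i => ?_⟩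
      simp [hk i, Nat.succ_le_of_lt h]
    · refine ⟨0, fun i => ?_⟩
      simp [h]

/-- The σ-algebra on trees generated by the events that a given vertex is present. -/
instance : MeasurableSpace PlaneTree :=
  MeasurableSpace.generateFrom (Set.range fun u : List ℕ => {t : PlaneTree | u ∈ t.verts})

/-- The tree in which the vertex `v`, if present, has exactly `ξ v` children. -/
def ofOffspring (ξ : List ℕ → ℕ) : PlaneTree where
  verts := {u | ∀ (v : List ℕ) (i : ℕ), v ++ [i] <+: u → i < ξ v}
  nil_mem := fun v i h => by simp at h
  parent_mem := fun u i h v j hv => h v j (hv.trans (List.prefix_append u [i]))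
  children := fun u hu => by
    refine ⟨ξ u, fun i => ⟨fun h => h u i (List.prefix_refl _), fun h v j hv => ?_⟩⟩
    rcases List.prefix_concat_iff.mp hv with hv | hv
    · obtain ⟨rfl, hij⟩ := List.append_inj' hv rfl
      simp only [List.cons.injEq, and_true] at hij
      exact hij ▸ h
    · exact hu v j hv

theorem measurable_ofOffspring : Measurable ofOffspring := by
  refine measurable_generateFrom ?_
  rintro _ ⟨u, rfl⟩
  have : ofOffspring ⁻¹' {t | u ∈ t.verts}
      = ⋂ (v : List ℕ) (i : ℕ) (_ : v ++ [i] <+: u), {ξ : List ℕ → ℕ | i < ξ v} := by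
    ext ξ
    simp [ofOffspring]
  rw [this]
  refine MeasurableSet.iInter fun v => MeasurableSet.iInter fun i => MeasurableSet.iInter fun _ => ?_
  exact measurableSet_lt measurable_const (measurable_pi_apply v)

end PlaneTree

/-- The law of the Galton-Watson tree `T` with offspring distribution `ν`: the numbers of children
of the individuals are independent with law `ν`. -/
noncomputable def gwLaw (ν : Measure ℕ) [IsProbabilityMeasure ν] : Measure PlaneTree :=
  (Measure.infinitePi fun _ : List ℕ => ν).map PlaneTree.ofOffspring

instance (ν : Measure ℕ) [IsProbabilityMeasure ν] : IsProbabilityMeasure (gwLaw ν) :=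
  Measure.isProbabilityMeasure_map PlaneTree.measurable_ofOffspring.aemeasurable

/-- The survival probability `pₙ = P(Zₙ > 0)`. -/
noncomputable def survivalProb (ν : Measure ℕ) [IsProbabilityMeasure ν] (n : ℕ) : ℝ :=
  (gwLaw ν).real {t | 0 < t.genSize n}

/-- `Q` is the law of the Galton-Watson tree conditioned to survive, `T*`: for every `n` and every
bounded function `φ` of trees of `n` generations,
`E φ(T*|ₙ) = lim_{m → ∞} E(φ(T|ₙ) | Z_{m+n} > 0)`. -/
def IsConditionedToSurvive (ν : Measure ℕ) [IsProbabilityMeasure ν] (Q : Measure PlaneTree) :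
    Prop :=
  IsProbabilityMeasure Q ∧
    ∀ (n : ℕ) (φ : PlaneTree → ℝ), (∃ C : ℝ, ∀ t, |φ t| ≤ C) →
      Tendsto (fun m : ℕ => ∫ t, φ (t.trunc n) ∂((gwLaw ν)[|{t | 0 < t.genSize (m + n)}])) atTop
        (𝓝 (∫ t, φ (t.trunc n) ∂Q))

/-- The offspring distribution `ν` of mean one is in the domain of attraction of a stable law with
index `α`: there are `aₙ ↑ ∞` such that `(Z[n] - n) / aₙ`, with `Z[n]` the sum of `n` independent
copies of `Z`, converges in distribution to a random variable `X` that satisfies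
`E exp(-r X) = exp(r ^ α)` for `r > 0`. (The integral is not zero, so the integrand is
integrable.) -/
def InDomainOfAttraction (ν : Measure ℕ) [IsProbabilityMeasure ν] (α : ℝ) : Prop :=
  ∃ (a : ℕ → ℝ) (X : Measure ℝ) (_ : IsProbabilityMeasure X),
    Monotone a ∧ Tendsto a atTop atTop ∧
    (∀ r : ℝ, 0 < r → ∫ x, Real.exp (-r * x) ∂X = Real.exp (r ^ α)) ∧
    TendstoInDistribution
      (fun (n : ℕ) (ω : ℕ → ℕ) => ((∑ i ∈ Finset.range n, (ω i : ℝ)) - n) / a n) atTop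
      (id : ℝ → ℝ) (fun _ => Measure.infinitePi fun _ : ℕ => ν) X

/-!
The law of `Zₙ*` is the size-biased law of `Zₙ`, that is `P(Zₙ* = k) = k P(Zₙ = k)`. Hence
`P(Zₙ* ≤ K) = E(Zₙ; Zₙ ≤ K) ≤ K P(Zₙ > 0) = K pₙ`, and with `K = r / pₙ` the probability in question
is at most `r`. Since `β < α - 1 ≤ 1`, this is at most `r ^ β` for `r ≤ 1`, and for `r ≥ 1` the
bound `r ^ β` is at least one. So `c = 1` works; what limits `β` is only that `r ≤ r ^ β` for small
`r`.

Only an upper bound on the law of `Zₙ*` is needed, and it is read off from the defining limit. A union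
bound over the individuals of generation `n`, whose subtrees are independent of the first `n`
generations, gives `P(Zₙ ≤ K, Z_{m+n} > 0) ≤ E(Zₙ; Zₙ ≤ K) pₘ ≤ K pₙ pₘ`
(`GaltonWatson.gwLaw_genSize_le_inter_survive_le`). Dividing by `p_{m+n}` and letting `m → ∞` leaves
`K pₙ`, because `pₘ / p_{m+n} → 1` (`GaltonWatson.tendsto_survivalProb_div_add`). The latter is where
criticality is used: with `f` the generating function of the offspring law,
`1 - p_{m+1} = f (1 - pₘ)` (`GaltonWatson.one_sub_survivalProb_succ`), so if `pₘ → 0` the ratio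
`p_{m+1} / pₘ` converges to `f'(1) = 1`, and if `pₘ` has a positive limit the claim is trivial.
-/

/-! ### Generations of plane trees -/

namespace PlaneTree

theorem mem_gen {t : PlaneTree} {n : ℕ} {u : List ℕ} :
    u ∈ t.gen n ↔ u ∈ t.verts ∧ u.length = n :=
  Iff.rfl

theorem gen_trunc (t : PlaneTree) (n : ℕ) : (t.trunc n).gen n = t.gen n := by
  ext u
  simp only [gen, trunc, Set.mem_ofPred_eq]
  constructor
  · rintro ⟨⟨h, -⟩, hl⟩
    exact ⟨h, hl⟩
  · rintro ⟨h, hl⟩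
    exact ⟨⟨h, hl.le⟩, hl⟩

theorem genSize_trunc (t : PlaneTree) (n : ℕ) : genSize n (t.trunc n) = genSize n t := by
  rw [genSize, genSize, gen_trunc]

theorem genSize_pos {t : PlaneTree} {n : ℕ} : 0 < genSize n t ↔ (t.gen n).Nonempty :=
  Set.ncard_pos (t.gen_finite n)

theorem genSize_zero (t : PlaneTree) : genSize 0 t = 1 := by
  have : t.gen 0 = {[]} := by
    ext u
    rw [mem_gen, List.length_eq_zero_iff, Set.mem_singleton_iff]
    exact ⟨fun h => h.2, fun h => ⟨h ▸ t.nil_mem, h⟩⟩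
  rw [genSize, this, Set.ncard_singleton]

theorem tsum_indicator_gen (t : PlaneTree) (n : ℕ) :
    ∑' u : List ℕ, (t.gen n).indicator (1 : List ℕ → ℝ≥0∞) u = genSize n t := by
  rw [← tsum_subtype]
  simp only [Pi.one_apply]
  rw [ENNReal.tsum_set_one, ← (t.gen_finite n).cast_ncard_eq]
  simp [genSize]

theorem measurableSet_mem_gen (n : ℕ) (u : List ℕ) : MeasurableSet {t : PlaneTree | u ∈ t.gen n} :=
  have h : MeasurableSet {t : PlaneTree | u ∈ t.verts} :=
    MeasurableSpace.measurableSet_generateFrom ⟨u, rfl⟩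
  h.inter (MeasurableSet.const (u.length = n))

theorem measurable_genSize (n : ℕ) : Measurable (genSize n) := by
  have h : Measurable fun t : PlaneTree => ((genSize n t : ℕ) : ℝ≥0∞) := by
    simp_rw [← tsum_indicator_gen]
    refine Measurable.tsum fun u => ?_
    exact measurable_one.indicator (measurableSet_mem_gen n u)
  refine measurable_to_countable' fun k => ?_
  convert h (measurableSet_singleton (k : ℝ≥0∞)) using 1
  ext t
  simp

theorem measurableSet_genSize_pos (n : ℕ) : MeasurableSet {t | 0 < genSize n t} :=
  measurable_genSize n measurableSet_Ioi

/-- The numbers of children of the descendants of `u`, relative to `u`. -/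
def shift (u : List ℕ) (ξ : List ℕ → ℕ) : List ℕ → ℕ := fun v => ξ (u ++ v)

theorem measurable_shift (u : List ℕ) : Measurable (shift u) :=
  measurable_pi_lambda _ fun v => measurable_pi_apply (u ++ v)

theorem append_mem_ofOffspring {ξ : List ℕ → ℕ} {u v : List ℕ} :
    u ++ v ∈ (ofOffspring ξ).verts ↔
      u ∈ (ofOffspring ξ).verts ∧ v ∈ (ofOffspring (shift u ξ)).verts := by
  constructor
  · intro h
    refine ⟨fun w i hw => h w i (hw.trans (List.prefix_append u v)), fun w i hw => ?_⟩
    refine h (u ++ w) i ?_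
    rw [List.append_assoc]
    exact (List.prefix_append_right_inj u).mpr hw
  · rintro ⟨hu, hv⟩ w i hw
    rcases List.prefix_or_prefix_of_prefix hw (List.prefix_append u v) with h | h
    · exact hu w i h
    · rcases List.prefix_concat_iff.mp h with h | ⟨x, rfl⟩
      · exact hu w i (h ▸ List.prefix_refl _)
      · rw [List.append_assoc] at hw
        exact hv x i ((List.prefix_append_right_inj u).mp hw)

theorem genSize_add_pos {ξ : List ℕ → ℕ} {m n : ℕ} :
    0 < genSize (m + n) (ofOffspring ξ) ↔
      ∃ u ∈ (ofOffspring ξ).gen n, 0 < genSize m (ofOffspring (shift u ξ)) := by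
  simp_rw [genSize_pos]
  constructor
  · rintro ⟨w, hw, hl⟩
    rw [← List.take_append_drop n w, append_mem_ofOffspring] at hw
    exact ⟨w.take n, ⟨hw.1, by simp [hl]⟩, w.drop n, hw.2, by simp [hl]⟩
  · rintro ⟨u, ⟨hu, hul⟩, v, hv, hvl⟩
    exact ⟨u ++ v, append_mem_ofOffspring.mpr ⟨hu, hv⟩, by simp [hul, hvl, add_comm]⟩

theorem mem_gen_one {ξ : List ℕ → ℕ} {u : List ℕ} :
    u ∈ (ofOffspring ξ).gen 1 ↔ ∃ i < ξ [], u = [i] := by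
  rw [mem_gen]
  constructor
  · rintro ⟨h, hl⟩
    obtain ⟨i, rfl⟩ := List.length_eq_one_iff.mp hl
    exact ⟨i, h [] i (List.prefix_refl _), rfl⟩
  · rintro ⟨i, hi, rfl⟩
    refine ⟨fun v j hv => ?_, rfl⟩
    rcases v with _ | ⟨a, v⟩
    · simp only [List.nil_append, List.cons_prefix_cons, List.prefix_rfl, and_true] at hv
      exact hv ▸ hi
    · simpa using hv.length_le

/-- The first `n` generations are determined by the offspring numbers of the words shorter
than `n`. -/
theorem gen_ofOffspring_congr {ξ η : List ℕ → ℕ} {n : ℕ}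
    (h : ∀ v : List ℕ, v.length < n → ξ v = η v) :
    (ofOffspring ξ).gen n = (ofOffspring η).gen n := by
  ext u
  refine and_congr_left fun hl => forall₂_congr fun v i => imp_congr_right fun hv => ?_
  have := hv.length_le
  rw [List.length_append, List.length_singleton] at this
  rw [h v (by omega)]

end PlaneTree

/-! ### The branching property -/

/-- Coordinates of a product measure that are grouped by a labelling are independent. -/
theorem iIndepFun_fiber_infinitePi {ι S X : Type*} [MeasurableSpace X] (P : Measure X)
    [IsProbabilityMeasure P] (g : ι → S) :
    iIndepFun (fun (s : S) (ω : ι → X) (w : {w // g w = s}) => ω w)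
      (Measure.infinitePi fun _ : ι => P) := by
  rw [iIndepFun_iff_map_fun_eq_infinitePi_map (by fun_prop)]
  have h1 (s : S) : (Measure.infinitePi fun _ : ι => P).map
      (fun (ω : ι → X) (w : {w // g w = s}) => ω w) = Measure.infinitePi fun _ => P :=
    Measure.map_infinitePi_infinitePi_of_inj Subtype.val_injective
  simp_rw [h1]
  have hinj : Function.Injective fun p : (s : S) × {w // g w = s} => (p.2 : ι) := by
    rintro ⟨s, w, rfl⟩ ⟨s', w', rfl⟩ h
    simp only at h
    subst h
    rfl
  have h2 := Measure.map_infinitePi_infinitePi_of_inj (P := fun _ : ι => P) hinj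
  rw [← Measure.infinitePi_map_piCurry (fun (s : S) (_ : {w // g w = s}) => P), ← h2,
    Measure.map_map (by fun_prop) (by fun_prop)]
  rfl

namespace GaltonWatson

open PlaneTree

/-- The block of a word relative to generation `n`: `none` for the words above generation `n`,
`some u` for the words that descend from the word `u` of length `n`. -/
def block (n : ℕ) (w : List ℕ) : Option (List ℕ) := if w.length < n then none else some (w.take n)

/-- The offspring numbers inside one block, extended by zero. -/
noncomputable def restrictBlock (n : ℕ) (o : Option (List ℕ)) (ξ : List ℕ → ℕ) : List ℕ → ℕ :=
  fun w => open Classical in if block n w = o then ξ w else 0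

theorem shift_restrictBlock {n : ℕ} {u : List ℕ} (hu : u.length = n) (ξ : List ℕ → ℕ) :
    shift u (restrictBlock n (some u) ξ) = shift u ξ := by
  subst hu
  ext v
  simp [shift, restrictBlock, block]

theorem gen_restrictBlock (n : ℕ) (ξ : List ℕ → ℕ) :
    (ofOffspring (restrictBlock n none ξ)).gen n = (ofOffspring ξ).gen n :=
  gen_ofOffspring_congr fun v hv => by simp [restrictBlock, block, hv]

variable (ν : Measure ℕ) [IsProbabilityMeasure ν]

/-- The joint law of the independent offspring numbers of all words. -/
noncomputable abbrev offspringLaw : Measure (List ℕ → ℕ) := Measure.infinitePi fun _ => ν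

theorem iIndepFun_restrictBlock (n : ℕ) : iIndepFun (restrictBlock n) (offspringLaw ν) := by
  classical
  refine (iIndepFun_fiber_infinitePi ν (block n)).comp
    (fun o y w => if h : block n w = o then y ⟨w, h⟩ else 0) fun o => ?_
  refine measurable_pi_lambda _ fun w => ?_
  by_cases h : block n w = o
  · simpa only [h, dite_true] using measurable_pi_apply _
  · simpa only [h, dite_false] using measurable_const

theorem map_shift (u : List ℕ) : (offspringLaw ν).map (shift u) = offspringLaw ν :=
  Measure.map_infinitePi_infinitePi_of_inj (P := fun _ : List ℕ => ν)
    (List.append_right_injective u)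

theorem gwLaw_apply {A : Set PlaneTree} (hA : MeasurableSet A) :
    gwLaw ν A = offspringLaw ν (ofOffspring ⁻¹' A) :=
  Measure.map_apply measurable_ofOffspring hA

theorem offspringLaw_shift_preimage (u : List ℕ) {A : Set PlaneTree} (hA : MeasurableSet A) :
    offspringLaw ν ((fun ξ => ofOffspring (shift u ξ)) ⁻¹' A) = gwLaw ν A := by
  rw [gwLaw_apply ν hA]
  conv_rhs => rw [← map_shift ν u]
  rw [Measure.map_apply (measurable_shift u) (measurable_ofOffspring hA)]
  rfl

/-- The subtree at a word `u` of length `n` is independent of the first `n` generations. -/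
theorem offspringLaw_inter_shift {n : ℕ} {u : List ℕ} (hu : u.length = n)
    {A B : Set PlaneTree} (hA : MeasurableSet A) (hB : MeasurableSet B)
    (hAn : ∀ s t : PlaneTree, s.gen n = t.gen n → (s ∈ A ↔ t ∈ A)) :
    offspringLaw ν (ofOffspring ⁻¹' A ∩ (fun ξ => ofOffspring (shift u ξ)) ⁻¹' B)
      = gwLaw ν A * gwLaw ν B := by
  have hind : IndepFun (restrictBlock n none) (restrictBlock n (some u)) (offspringLaw ν) :=
    (iIndepFun_restrictBlock ν n).indepFun (by simp)
  have h := hind.measure_inter_preimage_eq_mul (ofOffspring ⁻¹' A)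
    ((fun ξ => ofOffspring (shift u ξ)) ⁻¹' B) (measurable_ofOffspring hA)
    ((measurable_ofOffspring.comp (measurable_shift u)) hB)
  have e1 : restrictBlock n none ⁻¹' (ofOffspring ⁻¹' A) = ofOffspring ⁻¹' A :=
    Set.ext fun ξ => hAn _ _ (gen_restrictBlock n ξ)
  have e2 : restrictBlock n (some u) ⁻¹' ((fun ξ => ofOffspring (shift u ξ)) ⁻¹' B)
      = (fun ξ => ofOffspring (shift u ξ)) ⁻¹' B := by
    ext ξ
    simp only [Set.mem_preimage, shift_restrictBlock hu]
  rw [e1, e2, offspringLaw_shift_preimage ν u hB, ← gwLaw_apply ν hA] at h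
  exact h

/-- A union bound over the individuals of generation `n`: the event that generation `n` has at most
`K` individuals and that generation `m + n` is nonempty forces `Zₙ > 0` and one of at most `K`
independent subtrees to survive for `m` generations. -/
theorem gwLaw_genSize_le_inter_survive_le (K : ℝ) (m n : ℕ) :
    gwLaw ν ({t | (t.genSize n : ℝ) ≤ K} ∩ {t | 0 < t.genSize (m + n)})
      ≤ ENNReal.ofReal K * gwLaw ν {t | 0 < t.genSize n} * gwLaw ν {t | 0 < t.genSize m} := by
  set B : Set PlaneTree := {t | 0 < t.genSize m}
  set S : Set PlaneTree := {t | (t.genSize n : ℝ) ≤ K}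
  have hB : MeasurableSet B := measurableSet_genSize_pos m
  have hS : MeasurableSet S :=
    measurable_genSize n (MeasurableSet.of_discrete (s := {k : ℕ | (k : ℝ) ≤ K}))
  have hA (u : List ℕ) : MeasurableSet (S ∩ {t | u ∈ t.gen n}) :=
    hS.inter (measurableSet_mem_gen n u)
  rw [gwLaw_apply ν (hS.inter (measurableSet_genSize_pos _))]
  calc offspringLaw ν (ofOffspring ⁻¹' (S ∩ {t | 0 < t.genSize (m + n)}))
      ≤ offspringLaw ν (⋃ u : List ℕ, ofOffspring ⁻¹' (S ∩ {t | u ∈ t.gen n}) ∩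
          (fun ξ => ofOffspring (shift u ξ)) ⁻¹' B) := by
        refine measure_mono fun ξ hξ => ?_
        obtain ⟨u, hu, h⟩ := genSize_add_pos.mp hξ.2
        exact Set.mem_iUnion.mpr ⟨u, ⟨hξ.1, hu⟩, h⟩
    _ ≤ ∑' u : List ℕ, offspringLaw ν (ofOffspring ⁻¹' (S ∩ {t | u ∈ t.gen n}) ∩
          (fun ξ => ofOffspring (shift u ξ)) ⁻¹' B) := measure_iUnion_le _
    _ ≤ ∑' u : List ℕ, gwLaw ν (S ∩ {t | u ∈ t.gen n}) * gwLaw ν B := by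
        refine ENNReal.tsum_le_tsum fun u => ?_
        by_cases hu : u.length = n
        · refine (offspringLaw_inter_shift ν hu (hA u) hB fun s t hst => ?_).le
          simp only [S, genSize, Set.mem_inter_iff, Set.mem_ofPred_eq, hst]
        · have : S ∩ {t | u ∈ t.gen n} = ∅ :=
            Set.eq_empty_of_forall_notMem fun t ht => hu ht.2.2
          simp [this]
    _ = (∫⁻ t, S.indicator (fun t => (genSize n t : ℝ≥0∞)) t ∂gwLaw ν) * gwLaw ν B := by
        rw [ENNReal.tsum_mul_right]
        congr 1
        simp_rw [← lintegral_indicator_one (hA _)]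
        rw [← lintegral_tsum fun u => (measurable_one.indicator (hA u)).aemeasurable]
        refine lintegral_congr fun t => ?_
        by_cases ht : t ∈ S
        · rw [Set.indicator_of_mem ht, ← tsum_indicator_gen]
          refine tsum_congr fun u => ?_
          by_cases hu : u ∈ t.gen n <;> simp [Set.indicator, ht, hu]
        · simp [Set.indicator, ht]
    _ ≤ (∫⁻ t, ENNReal.ofReal K * {t | 0 < t.genSize n}.indicator 1 t ∂gwLaw ν) * gwLaw ν B := by
        refine mul_le_mul_left (lintegral_mono fun t => ?_) _
        by_cases ht : t ∈ S
        · by_cases h0 : 0 < genSize n t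
          · rw [Set.indicator_of_mem ht, Set.indicator_of_mem (by exact h0), Pi.one_apply,
              mul_one, ← ENNReal.ofReal_natCast]
            exact ENNReal.ofReal_le_ofReal ht
          · simp [Set.indicator, Nat.eq_zero_of_not_pos h0]
        · simp [Set.indicator, ht]
    _ = _ := by
        rw [lintegral_const_mul _ (measurable_one.indicator (measurableSet_genSize_pos n)),
          lintegral_indicator_one (measurableSet_genSize_pos n)]

/-- The extinction probabilities are the iterates at zero of the generating function of `ν`. -/
theorem gwLaw_extinct_succ (m : ℕ) :
    gwLaw ν {t | t.genSize (m + 1) = 0} = ∫⁻ k, gwLaw ν {t | t.genSize m = 0} ^ k ∂ν := by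
  set D : Set PlaneTree := {t | t.genSize m = 0}
  have hD : MeasurableSet D := measurable_genSize m (measurableSet_singleton 0)
  have hroot (k : ℕ) : MeasurableSet ((fun ξ : List ℕ → ℕ => ξ []) ⁻¹' {k}) :=
    measurable_pi_apply [] (measurableSet_singleton k)
  have hdec : ofOffspring ⁻¹' {t | t.genSize (m + 1) = 0} = ⋃ k : ℕ, (fun ξ => ξ []) ⁻¹' {k} ∩
      ⋂ i ∈ Finset.range k, (fun ξ => ofOffspring (shift [i] ξ)) ⁻¹' D := by
    ext ξ
    have h := (genSize_add_pos (ξ := ξ) (m := m) (n := 1)).not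
    simp only [mem_gen_one, Nat.pos_iff_ne_zero, not_not] at h
    simp only [Set.mem_preimage, Set.mem_ofPred_eq, h, Set.mem_iUnion, Set.mem_inter_iff,
      Set.mem_singleton_iff, Set.mem_iInter, Finset.mem_range, exists_eq_left', D]
    constructor
    · intro h i hi
      by_contra hne
      exact h ⟨[i], ⟨i, hi, rfl⟩, hne⟩
    · rintro h ⟨_, ⟨i, hi, rfl⟩, hne⟩
      exact hne (h i hi)
  have hD' : MeasurableSet {t | genSize (m + 1) t = 0} :=
    measurable_genSize (m + 1) (measurableSet_singleton 0)
  rw [gwLaw_apply ν hD', lintegral_countable', hdec, measure_iUnion]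
  · refine tsum_congr fun k => ?_
    -- the blocks that carry the root and the subtrees of the first `k` children
    let I : Finset (Option (List ℕ)) := Finset.insertNone ((Finset.range k).image fun i => [i])
    let F : Option (List ℕ) → Set (List ℕ → ℕ) := fun o =>
      o.elim ((fun ξ => ξ []) ⁻¹' {k}) fun u => (fun ξ => ofOffspring (shift u ξ)) ⁻¹' D
    have hF (o) : MeasurableSet (F o) := by
      cases o with
      | none => exact hroot k
      | some u => exact (measurable_ofOffspring.comp (measurable_shift u)) hD
    have h := (iIndepFun_restrictBlock ν 1).measure_inter_preimage_eq_mul I (sets := F)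
      fun o _ => hF o
    have e0 : restrictBlock 1 none ⁻¹' F none = (fun ξ => ξ []) ⁻¹' {k} := by
      ext ξ
      simp [F, restrictBlock, block]
    have e1 (i : ℕ) : restrictBlock 1 (some [i]) ⁻¹' F (some [i])
        = (fun ξ => ofOffspring (shift [i] ξ)) ⁻¹' D := by
      ext ξ
      have hs := shift_restrictBlock (List.length_singleton (a := i)) ξ
      simp only [F, Option.elim, Set.mem_preimage, hs]
    have hmarg : offspringLaw ν ((fun ξ => ξ []) ⁻¹' {k}) = ν {k} := by
      rw [← Measure.map_apply (measurable_pi_apply []) (measurableSet_singleton k),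
        Measure.infinitePi_map_eval]
    have hinj : Function.Injective fun i : ℕ => [i] := fun i j h => by simpa using h
    rw [Finset.prod_insertNone, Finset.prod_image hinj.injOn, e0, hmarg] at h
    simp only [e1, offspringLaw_shift_preimage ν _ hD, Finset.prod_const, Finset.card_range] at h
    rw [mul_comm, ← h]
    congr 1
    ext ξ
    simp only [Set.mem_inter_iff, Set.mem_iInter, Finset.mem_range, I, Option.forall,
      Finset.none_mem_insertNone, Finset.some_mem_insertNone, Finset.mem_image, forall_true_left,
      ← e0, ← e1, forall_exists_index, and_imp]
    exact and_congr_right fun _ => ⟨fun h _ i hi he => he ▸ h i hi, fun h i hi => h _ i hi rfl⟩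
  · intro j k hjk
    refine Set.disjoint_left.mpr fun ξ h1 h2 => hjk ?_
    exact (h1.1 : ξ [] = j).symm.trans h2.1
  · intro k
    refine (hroot k).inter (Finset.measurableSet_biInter _ fun i _ => ?_)
    exact (measurable_ofOffspring.comp (measurable_shift [i])) hD

/-! ### Survival probabilities of a critical tree -/

theorem survivalProb_nonneg (m : ℕ) : 0 ≤ survivalProb ν m := measureReal_nonneg

theorem survivalProb_le_one (m : ℕ) : survivalProb ν m ≤ 1 := measureReal_le_one

theorem survivalProb_zero : survivalProb ν 0 = 1 := by
  simp [survivalProb, genSize_zero]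

theorem one_sub_survivalProb (m : ℕ) :
    1 - survivalProb ν m = (gwLaw ν).real {t | t.genSize m = 0} := by
  rw [survivalProb, ← probReal_compl_eq_one_sub (measurableSet_genSize_pos m)]
  congr 1
  ext t
  simp

theorem one_sub_survivalProb_succ (m : ℕ) :
    1 - survivalProb ν (m + 1) = ∫ k, (1 - survivalProb ν m) ^ k ∂ν := by
  simp_rw [one_sub_survivalProb, Measure.real, gwLaw_extinct_succ ν m, ← ENNReal.toReal_pow]
  refine (integral_toReal (measurable_of_countable _).aemeasurable (ae_of_all _ fun k => ?_)).symm
  exact ENNReal.pow_lt_top (measure_lt_top _ _)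

/-- The ratio of consecutive survival probabilities: with `f` the generating function of `ν`, this
is the difference quotient `(1 - f (1 - p)) / p`, written as a geometric sum so that it also makes
sense at `p = 0`. -/
noncomputable def survivalRatio (p : ℝ) : ℝ := ∫ k : ℕ, ∑ j ∈ Finset.range k, (1 - p) ^ j ∂ν

theorem survivalProb_succ (m : ℕ) :
    survivalProb ν (m + 1) = survivalProb ν m * survivalRatio ν (survivalProb ν m) := by
  have h0 := survivalProb_nonneg ν m
  have h1 := survivalProb_le_one ν m
  have hint : Integrable (fun k : ℕ => (1 - survivalProb ν m) ^ k) ν := by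
    refine Integrable.of_bound (measurable_of_countable _).aestronglyMeasurable 1
      (ae_of_all _ fun k => ?_)
    rw [Real.norm_of_nonneg (by positivity [sub_nonneg.mpr h1])]
    exact pow_le_one₀ (by linarith) (by linarith)
  have h := one_sub_survivalProb_succ ν m
  have h2 : ∫ k : ℕ, (1 - (1 - survivalProb ν m) ^ k) ∂ν
      = 1 - ∫ k, (1 - survivalProb ν m) ^ k ∂ν := by
    rw [integral_sub (integrable_const _) hint]
    simp
  rw [survivalRatio, ← integral_const_mul]
  calc survivalProb ν (m + 1) = ∫ k : ℕ, (1 - (1 - survivalProb ν m) ^ k) ∂ν := by linarith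
    _ = _ := integral_congr_ae (ae_of_all _ fun k => by
        simpa using (mul_neg_geom_sum (1 - survivalProb ν m) k).symm)

theorem geom_sum_one_sub_le {p : ℝ} (hp : 0 ≤ p) (hp1 : p ≤ 1) (k : ℕ) :
    ∑ j ∈ Finset.range k, (1 - p) ^ j ≤ k := by
  calc ∑ j ∈ Finset.range k, (1 - p) ^ j ≤ ∑ j ∈ Finset.range k, (1 : ℝ) :=
        Finset.sum_le_sum fun j _ => pow_le_one₀ (by linarith) (by linarith)
    _ = k := by simp

theorem geom_sum_one_sub_nonneg {p : ℝ} (hp1 : p ≤ 1) (k : ℕ) :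
    0 ≤ ∑ j ∈ Finset.range k, (1 - p) ^ j :=
  Finset.sum_nonneg fun _ _ => pow_nonneg (by linarith) _

variable {ν}

theorem integrable_natCast {ν : Measure ℕ} (hmean : ∫⁻ k, (k : ℝ≥0∞) ∂ν = 1) :
    Integrable (fun k : ℕ => (k : ℝ)) ν := by
  refine ⟨(measurable_of_countable _).aestronglyMeasurable, ?_⟩
  rw [hasFiniteIntegral_iff_ofReal (ae_of_all _ fun k => Nat.cast_nonneg k)]
  simp [hmean]

theorem integral_natCast {ν : Measure ℕ} (hmean : ∫⁻ k, (k : ℝ≥0∞) ∂ν = 1) :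
    ∫ k : ℕ, (k : ℝ) ∂ν = 1 := by
  rw [integral_eq_lintegral_of_nonneg_ae (ae_of_all _ fun k => Nat.cast_nonneg k)
    (measurable_of_countable _).aestronglyMeasurable]
  simp [hmean]

theorem integrable_geom_sum {ν : Measure ℕ} (hmean : ∫⁻ k, (k : ℝ≥0∞) ∂ν = 1) {p : ℝ}
    (hp : 0 ≤ p) (hp1 : p ≤ 1) :
    Integrable (fun k : ℕ => ∑ j ∈ Finset.range k, (1 - p) ^ j) ν := by
  refine (integrable_natCast hmean).mono' (measurable_of_countable _).aestronglyMeasurable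
    (ae_of_all _ fun k => ?_)
  rw [Real.norm_of_nonneg (geom_sum_one_sub_nonneg hp1 k)]
  exact geom_sum_one_sub_le hp hp1 k

theorem survivalRatio_le_one {ν : Measure ℕ} (hmean : ∫⁻ k, (k : ℝ≥0∞) ∂ν = 1) {p : ℝ}
    (hp : 0 ≤ p) (hp1 : p ≤ 1) : survivalRatio ν p ≤ 1 := by
  rw [← integral_natCast hmean]
  exact integral_mono (integrable_geom_sum hmean hp hp1) (integrable_natCast hmean)
    (geom_sum_one_sub_le hp hp1)

theorem survivalRatio_pos {ν : Measure ℕ} (hmean : ∫⁻ k, (k : ℝ≥0∞) ∂ν = 1) {p : ℝ}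
    (hp : 0 ≤ p) (hp1 : p ≤ 1) : 0 < survivalRatio ν p := by
  refine (integral_nonneg (geom_sum_one_sub_nonneg hp1)).lt_of_ne' fun h => ?_
  rw [integral_eq_zero_iff_of_nonneg (geom_sum_one_sub_nonneg hp1)
    (integrable_geom_sum hmean hp hp1)] at h
  -- the sum contains the term `(1 - p) ^ 0 = 1` unless `k = 0`, so `ν` would be concentrated at `0`
  have hz : ∀ᵐ k ∂ν, ((k : ℕ) : ℝ≥0∞) = 0 := by
    filter_upwards [h] with k hk
    rcases k with _ | k
    · simp
    · rw [Finset.sum_range_succ'] at hk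
      have h2 : 0 ≤ ∑ j ∈ Finset.range k, (1 - p) ^ (j + 1) :=
        Finset.sum_nonneg fun _ _ => pow_nonneg (by linarith) _
      simp only [pow_zero, Pi.zero_apply] at hk
      linarith
  rw [lintegral_congr_ae hz, lintegral_zero] at hmean
  exact zero_ne_one hmean

/-- The generating function of `ν` has derivative one at `1`. -/
theorem tendsto_survivalRatio {ν : Measure ℕ} (hmean : ∫⁻ k, (k : ℝ≥0∞) ∂ν = 1) {p : ℕ → ℝ}
    (hp : ∀ m, 0 ≤ p m) (hp1 : ∀ m, p m ≤ 1) (h0 : Tendsto p atTop (𝓝 0)) :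
    Tendsto (fun m => survivalRatio ν (p m)) atTop (𝓝 1) := by
  rw [← integral_natCast hmean]
  refine tendsto_integral_of_dominated_convergence (fun k : ℕ => (k : ℝ))
    (fun m => (measurable_of_countable _).aestronglyMeasurable) (integrable_natCast hmean)
    (fun m => ae_of_all _ fun k => ?_) (ae_of_all _ fun k => ?_)
  · rw [Real.norm_of_nonneg (geom_sum_one_sub_nonneg (hp1 m) k)]
    exact geom_sum_one_sub_le (hp m) (hp1 m) k
  · have h : Tendsto (fun m => ∑ j ∈ Finset.range k, (1 - p m) ^ j) atTop
        (𝓝 (∑ j ∈ Finset.range k, (1 - 0 : ℝ) ^ j)) :=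
      tendsto_finsetSum _ fun j _ => (tendsto_const_nhds.sub h0).pow j
    simpa using h

theorem survivalProb_pos (hmean : ∫⁻ k, (k : ℝ≥0∞) ∂ν = 1) (m : ℕ) : 0 < survivalProb ν m := by
  induction m with
  | zero => simp [survivalProb_zero]
  | succ m ih =>
    rw [survivalProb_succ]
    exact mul_pos ih (survivalRatio_pos hmean ih.le (survivalProb_le_one ν m))

theorem antitone_survivalProb (hmean : ∫⁻ k, (k : ℝ≥0∞) ∂ν = 1) : Antitone (survivalProb ν) := by
  refine antitone_nat_of_succ_le fun m => ?_
  rw [survivalProb_succ]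
  exact mul_le_of_le_one_right (survivalProb_nonneg ν m)
    (survivalRatio_le_one hmean (survivalProb_nonneg ν m) (survivalProb_le_one ν m))

theorem tendsto_survivalProb_div_succ (hmean : ∫⁻ k, (k : ℝ≥0∞) ∂ν = 1) :
    Tendsto (fun m => survivalProb ν m / survivalProb ν (m + 1)) atTop (𝓝 1) := by
  have hbdd : BddBelow (Set.range (survivalProb ν)) :=
    ⟨0, by rintro _ ⟨m, rfl⟩; exact survivalProb_nonneg ν m⟩
  have hlim := tendsto_atTop_ciInf (antitone_survivalProb hmean) hbdd
  set q := ⨅ m, survivalProb ν m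
  rcases eq_or_ne q 0 with hq | hq
  · rw [hq] at hlim
    have h := (tendsto_survivalRatio hmean (survivalProb_nonneg ν) (survivalProb_le_one ν)
      hlim).inv₀ one_ne_zero
    rw [inv_one] at h
    refine h.congr fun m => ?_
    have := (survivalProb_pos hmean m).ne'
    rw [survivalProb_succ, div_mul_cancel_left₀ this]
  · -- a deterministic tree, the only critical one that survives forever with positive probability
    have h := hlim.div (hlim.comp (tendsto_add_atTop_nat 1)) hq
    rwa [div_self hq] at h

theorem tendsto_survivalProb_div_add (hmean : ∫⁻ k, (k : ℝ≥0∞) ∂ν = 1) (n : ℕ) :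
    Tendsto (fun m => survivalProb ν m / survivalProb ν (m + n)) atTop (𝓝 1) := by
  induction n with
  | zero =>
    refine tendsto_const_nhds.congr fun m => ?_
    rw [add_zero, div_self (survivalProb_pos hmean m).ne']
  | succ n ih =>
    have h := ih.mul ((tendsto_survivalProb_div_succ hmean).comp (tendsto_add_atTop_nat n))
    rw [mul_one] at h
    refine h.congr fun m => ?_
    simp only [Function.comp_apply]
    rw [div_mul_div_cancel₀ (survivalProb_pos hmean _).ne', add_assoc]

/-! ### The size of a generation of the conditioned tree -/

/-- The quantitative form of size biasing: for a critical tree conditioned to survive,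
`P(Zₙ* ≤ K) ≤ E(Zₙ; Zₙ ≤ K) ≤ K pₙ`. -/
theorem conditioned_genSize_le (hmean : ∫⁻ k, (k : ℝ≥0∞) ∂ν = 1) {Q : Measure PlaneTree}
    (hQ : IsConditionedToSurvive ν Q) {K : ℝ} (hK : 0 ≤ K) (n : ℕ) :
    Q.real {t | (t.genSize n : ℝ) ≤ K} ≤ K * survivalProb ν n := by
  set S : Set PlaneTree := {t | (t.genSize n : ℝ) ≤ K}
  have hS : MeasurableSet S :=
    measurable_genSize n (MeasurableSet.of_discrete (s := {k : ℕ | (k : ℝ) ≤ K}))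
  have hφ : ∀ t : PlaneTree, S.indicator (1 : PlaneTree → ℝ) (t.trunc n) = S.indicator 1 t := by
    intro t
    simp only [Set.indicator, S, Set.mem_ofPred_eq, genSize_trunc]
    rfl
  have hlim := hQ.2 n (S.indicator 1) ⟨1, fun t => by
    by_cases ht : t ∈ S <;> simp [ht]⟩
  simp_rw [hφ, integral_indicator_one hS] at hlim
  have hub := (tendsto_survivalProb_div_add hmean n).const_mul (K * survivalProb ν n)
  rw [mul_one] at hub
  refine le_of_tendsto_of_tendsto' hlim hub fun m => ?_
  have hle := ENNReal.toReal_mono (by finiteness) (gwLaw_genSize_le_inter_survive_le ν K m n)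
  rw [ENNReal.toReal_mul, ENNReal.toReal_mul, ENNReal.toReal_ofReal hK] at hle
  have hpos := survivalProb_pos hmean (m + n)
  rw [Measure.real, cond_apply (measurableSet_genSize_pos _), ENNReal.toReal_mul,
    ENNReal.toReal_inv, Set.inter_comm, ← mul_div_assoc, inv_mul_eq_div]
  exact div_le_div_of_nonneg_right hle hpos.le

end GaltonWatson

theorem mainTheorem7 (ν : Measure ℕ) [IsProbabilityMeasure ν]
    (hmean : ∫⁻ k, (k : ℝ≥0∞) ∂ν = 1)
    (α : ℝ) (hα : 1 < α) (hα2 : α ≤ 2) (hν : InDomainOfAttraction ν α)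
    (Q : Measure PlaneTree) (hQ : IsConditionedToSurvive ν Q)
    (β : ℝ) (hβ : 0 < β) (hβα : β < α - 1) :
    ∃ c : ℝ, ∀ (n : ℕ) (r : ℝ), 0 < r →
      Q.real {t | (t.genSize n : ℝ) ≤ r * (survivalProb ν n)⁻¹} ≤ c * r ^ β := by
  have := hQ.1
  refine ⟨1, fun n r hr => ?_⟩
  rw [one_mul]
  rcases le_total r 1 with hr1 | hr1
  · have hp := GaltonWatson.survivalProb_pos hmean n
    calc Q.real {t | (t.genSize n : ℝ) ≤ r * (survivalProb ν n)⁻¹}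
        ≤ r * (survivalProb ν n)⁻¹ * survivalProb ν n :=
          GaltonWatson.conditioned_genSize_le hmean hQ (by positivity) n
      _ = r ^ (1 : ℝ) := by rw [inv_mul_cancel_right₀ hp.ne', Real.rpow_one]
      _ ≤ r ^ β := Real.rpow_le_rpow_of_exponent_ge hr hr1 (by linarith)
  · exact measureReal_le_one.trans (Real.one_le_rpow hr1 hβ.le)
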